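/- **Memory logics.** A memory model is $\mathcal M=\langle W,R,V,S\rangle$ with $W\neq\emptyset$, $R\subseteq W\times W$, $V:\{p_0,p_1,\dots\}\to\mathcal P(W)$ and $S\subseteq W$ (the memory). Put $\mathcal M[+w]=\langle W,R,V,S\cup\{w\}\rangle$, $\mathcal M[-w]=\langle W,R,V,S\setminus\{w\}\rangle$, $\mathcal M[*]=\langle W,R,V,\emptyset\rangle$. A memory logic $\mathfrak L$ is propositional calculus over the $p_i$ together with a set of operators among $k,r,f,e,\langle r\rangle,\langle\langle r\rangle\rangle$ (known, remember, forget, erase, diamond, double diamond) that contains at least $k$ and $r$. Truth is defined by the usual Boolean clauses and: $\mathcal M,w\models k$ iff $w\in S$; $\mathcal M,w\models r\varphi$ iff $\mathcal M[+w],w\models\varphi$; $\mathcal M,w\models f\varphi$ iff $\mathcal M[-w],w\models\varphi$; $\mathcal M,w\models e\varphi$ iff $\mathcal M[*],w\models\varphi$; $\mathcal M,w\models\langle r\rangle\varphi$ iff $\mathcal M,w'\models\varphi$ for some $w'$ with $wRw'$; $\mathcal M,w\models\langle\langle r\rangle\rangle\varphi$ iff $\mathcal M[+w],w'\models\varphi$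 for some $w'$ with $wRw'$. Write $\mathrm{Th}(\mathcal M,w)$ for the set of $\mathfrak L$-formulas true at $w$ in $\mathcal M$. An $\mathfrak L$-simulation is a nonempty relation $\sim$ between pointed memory models such that $\langle\mathcal M,m\rangle\sim\langle\mathcal N,n\rangle$ implies: $m,n$ satisfy the same $p_i$; and, for each operator of $\mathfrak L$, the corresponding condition: ($k$) $m\in S^{\mathcal M}$ iff $n\in S^{\mathcal N}$; ($r$) $\langle\mathcal M[+m],m\rangle\sim\langle\mathcal N[+n],n\rangle$; ($f$) $\langle\mathcal M[-m],m\rangle\sim\langle\mathcal N[-n],n\rangle$; ($e$) $\langle\mathcal M[*],m\rangle\sim\langle\mathcal N[*],n\rangle$; ($\langle r\rangle$) for every $R$-successor $m'$ of $m$ there is an $R$-successor $n'$ of $n$ with $\langle\mathcal M,m'\rangle\sim\langle\mathcal N,n'\rangle$, and conversely; ($\langle\langle r\rangle\rangle$) for every $R$-successor $m'$ of $m$ there is an $R$-successor $n'$ of $n$ with $\langle\mathcal M[+m],m'\rangle\sim\langle\mathcal N[+n],n'\rangle$, and conversely. Write $\mathcal M,w\rightarrow_{\mathfrak L}\mathcal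 N,v$ if some $\mathfrak L$-simulation relates $\langle\mathcal M,w\rangle$ to $\langle\mathcal N,v\rangle$. **First-order side.** The target language has equality, unary predicates $P_i$ ($i\in\mathbb N$) and $K$, and a binary predicate $R$. A pointed first-order model $\langle\mathcal A,g\rangle$ is a nonempty structure with an assignment $g$ of the variable $x$; $\mathsf K$ is the class of all of them. The model translation $\mathsf T(\langle W,R,V,S\rangle,w)$ is the structure with domain $W$ in which $P_i,K,R$ are interpreted as $V(p_i),S,R$, with $g(x)=w$. A class of pointed models is closed under ultraproducts if for all members $\langle\mathcal A_i,g_i\rangle$ $(i\in I)$ and every ultrafilter $U$ on $I$ it contains $\prod_U\mathcal A_i$ with $x$ assigned the class of $i\mapsto g_i(x)$; closed under ultrapowers means this for constant families. A formula translation is a map $\mathsf{Tf}_x$ from $\mathfrak L$-formulas to first-order formulas with at most $x$ free such that, for $\odot\in\{\wedge,\vee\}$ and all $\varphi_1,\varphi_2$, the formula $\mathsf{Tf}_x(\varphi_1)\odot\mathsf{Tf}_x(\varphi_2)$ is logically equivalent to $\mathsf{Tf}_x(\psi)$ for some $\psi$. It is truth-preserving (together with $\mathsf T$) if $\mathcal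 M,w\models\varphi$ iff $\mathsf T(\mathcal M,w)\models\mathsf{Tf}_x(\varphi)$ for all $\varphi$ and $\mathcal M,w$. A structure is $\omega$-saturated if for every finite set $A$ of its elements, every set of formulas in one free variable with parameters in $A$ that is finitely realizable in it is realized in it; a memory model is $\omega$-saturated if its translation is. **Theorem.** For every memory logic $\mathfrak L$: 1. (Adequacy) $\langle\mathfrak L,\mathsf K\rangle$ is an adequate pair: $\mathsf K$ is closed under ultraproducts; $\mathsf T$ is a bijection from the pointed memory models onto $\mathsf K$; there is a formula translation $\mathsf{Tf}_x$ that is truth-preserving together with $\mathsf T$; if $\langle\mathcal M,w\rangle$ and $\langle\mathcal N,v\rangle$ are related by an $\mathfrak L$-simulation then $\mathrm{Th}(\mathcal M,w)\subseteq\mathrm{Th}(\mathcal N,v)$; and for $\omega$-saturated $\mathcal M,\mathcal N$, $\mathrm{Th}(\mathcal M,w)\subseteq\mathrm{Th}(\mathcal N,v)$ implies $\mathcal M,w\rightarrow_{\mathfrak L}\mathcal N,v$. 2. (Characterization) For every truth-preserving formula translation $\mathsf{Tf}_x$, a first-order formula $\alpha(x)$ is $\mathsf K$-equivalent to $\mathsf{Tf}_x(\varphi)$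 for some $\mathfrak L$-formula $\varphi$ if and only if it is $\mathsf K$-invariant for $\mathfrak L$-simulations, i.e. $\mathcal M,w\rightarrow_{\mathfrak L}\mathcal N,v$ and $\mathsf T(\mathcal M,w)\models\alpha$ imply $\mathsf T(\mathcal N,v)\models\alpha$. 3. (Definability by a set) A class $\mathsf M$ of pointed memory models is the class of pointed models of a set of $\mathfrak L$-formulas if and only if $\mathsf M$ is closed under $\mathfrak L$-simulations (if $\langle\mathcal M,w\rangle\in\mathsf M$ and $\mathcal M,w\rightarrow_{\mathfrak L}\mathcal N,v$ then $\langle\mathcal N,v\rangle\in\mathsf M$), $\mathsf T(\mathsf M)$ is closed under ultraproducts and $\mathsf T(\overline{\mathsf M})$ is closed under ultrapowers, where $\overline{\mathsf M}$ is the complement of $\mathsf M$ in the class of pointed memory models. 4. (Definability by a formula) A class $\mathsf M$ of pointed memory models is the class of pointed models of a single $\mathfrak L$-formula if and only if $\mathsf M$ is closed under $\mathfrak L$-simulations and both $\mathsf T(\mathsf M)$ and $\mathsf T(\overline{\mathsf M})$ are closed under ultraproducts. In particular this holds for $\mathcal{ML}(\langle r\rangle)$, whose operators are $k,r,\langle r\rangle$,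 for $\mathcal{ML}(\langle\langle r\rangle\rangle)$, whose operators are $k,r,\langle\langle r\rangle\rangle$, and for their variants with forget and/or erase. -/

import Mathlib

open FirstOrder

universe u

/-! ### Source logics and first-order pointed models -/

/-- A source logic over Kripke-like models. Its language extends the language with propositional
variables `p i` (`i : ℕ`), conjunction, disjunction, verum and falsum. -/
structure SourceLogic where
  /-- formulas -/
  Form : Type
  /-- models -/
  Model : Type (u + 1)
  /-- the domain of a model -/
  World : Model → Type u
  nonempty_world : ∀ M, Nonempty (World M)
  /-- the valuation of a model -/
  val : (M : Model) → ℕ → Set (World M)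
  /-- truth at a point of a model -/
  Sat : (M : Model) → World M → Form → Prop
  /-- propositional variables -/
  var : ℕ → Form
  verum : Form
  falsum : Form
  conj : Form → Form → Form
  disj : Form → Form → Form
  sat_var : ∀ M w i, Sat M w (var i) ↔ w ∈ val M i
  sat_verum : ∀ M w, Sat M w verum
  sat_falsum : ∀ M w, ¬ Sat M w falsum
  sat_conj : ∀ M w φ ψ, Sat M w (conj φ ψ) ↔ Sat M w φ ∧ Sat M w ψ
  sat_disj : ∀ M w φ ψ, Sat M w (disj φ ψ) ↔ Sat M w φ ∨ Sat M w ψ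

/-- Pointed models of a source logic. -/
abbrev SourceLogic.Pointed (𝔏 : SourceLogic.{u}) : Type (u + 1) :=
  Σ M : 𝔏.Model, 𝔏.World M

/-- The theory of a pointed model. -/
def SourceLogic.Th (𝔏 : SourceLogic.{u}) (P : 𝔏.Pointed) : Set 𝔏.Form :=
  {φ | 𝔏.Sat P.1 P.2 φ}

/-- All (nonempty) first-order models of the language `L`, with domain in `Type u`. -/
abbrev FOModel (L : FirstOrder.Language.{0, 0}) : Type (u + 1) :=
  FirstOrder.Language.Theory.ModelType.{0, 0, u} (∅ : L.Theory)

/-- First-order pointed models: a model with an `x`-assignment. The variable `x` is the unique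
element of `Unit`, and the formulas with at most the free variable `x` are `L.Formula Unit`. -/
abbrev FOPointed (L : FirstOrder.Language.{0, 0}) : Type (u + 1) :=
  Σ M : FOModel.{u} L, (Unit → M)

/-- `⟨M, g⟩ ⊨ α(x)`. -/
def FOPointed.Models {L : FirstOrder.Language.{0, 0}} (P : FOPointed.{u} L) (α : L.Formula Unit) : Prop :=
  α.Realize P.2

/-! ### Ultraproducts -/

/-- The ultraproduct of a family of first-order models. -/
noncomputable def FOModel.ultraproduct {L : FirstOrder.Language.{0, 0}} {I : Type u} (U : Ultrafilter I)
    (M : I → FOModel.{u} L) : FOModel.{u} L :=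
  FirstOrder.Language.Theory.ModelType.of ∅ ((U : Filter I).Product fun i => (M i : Type u))

/-- The ultraproduct of a family of pointed models: `x` is assigned the class of `i ↦ gᵢ(x)`. -/
noncomputable def FOPointed.ultraproduct {L : FirstOrder.Language.{0, 0}} {I : Type u} (U : Ultrafilter I)
    (P : I → FOPointed.{u} L) : FOPointed.{u} L :=
  ⟨FOModel.ultraproduct U fun i => (P i).1,
    fun x => ((fun i => (P i).2 x : ∀ i, ((P i).1 : Type u)) :
      (U : Filter I).Product fun i => ((P i).1 : Type u))⟩

/-- Closure of a class of pointed models under ultraproducts. -/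
def ClosedUnderUltraproducts {L : FirstOrder.Language.{0, 0}} (K : Set (FOPointed.{u} L)) : Prop :=
  ∀ (I : Type u) (U : Ultrafilter I) (P : I → FOPointed.{u} L),
    (∀ i, P i ∈ K) → FOPointed.ultraproduct U P ∈ K

/-- Closure of a class of pointed models under ultrapowers. -/
def ClosedUnderUltrapowers {L : FirstOrder.Language.{0, 0}} (K : Set (FOPointed.{u} L)) : Prop :=
  ∀ (I : Type u) (U : Ultrafilter I) (P : FOPointed.{u} L),
    P ∈ K → FOPointed.ultraproduct U (fun _ : I => P) ∈ K

/-! ### Saturation -/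

/-- `ω`-saturation: for every finite set `A` of parameters, every set of formulas in one free
variable over the language with constants for `A` that is finitely realizable has a witness. -/
def FOModel.OmegaSaturated {L : FirstOrder.Language.{0, 0}} (M : FOModel.{u} L) : Prop :=
  ∀ A : Set M, A.Finite → ∀ Γ : Set ((L[[A]]).Formula Unit),
    (∀ Δ : Set ((L[[A]]).Formula Unit), Δ ⊆ Γ → Δ.Finite →
      ∃ w : M, ∀ φ ∈ Δ, φ.Realize (fun _ => w)) →
    ∃ w : M, ∀ φ ∈ Γ, φ.Realize (fun _ => w)

/-! ### Translations, simulations, adequate pairs -/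

/-- `K`-equivalence of formulas with at most the free variable `x`. -/
def KEquivalent {L : FirstOrder.Language.{0, 0}} (K : Set (FOPointed.{u} L)) (α β : L.Formula Unit) : Prop :=
  ∀ P ∈ K, P.Models α ↔ P.Models β

section Framework

variable (𝔏 : SourceLogic.{u}) {L : FirstOrder.Language.{0, 0}}

/-- A formula translation preserves conjunctions and disjunctions up to first-order equivalence. -/
def IsFormulaTranslation (Tf : 𝔏.Form → L.Formula Unit) : Prop :=
  (∀ φ₁ φ₂, ∃ ψ, KEquivalent (Set.univ : Set (FOPointed.{u} L)) (Tf ψ) (Tf φ₁ ⊓ Tf φ₂)) ∧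
  (∀ φ₁ φ₂, ∃ ψ, KEquivalent (Set.univ : Set (FOPointed.{u} L)) (Tf ψ) (Tf φ₁ ⊔ Tf φ₂))

/-- A model translation is a bijection from the pointed models of `𝔏` onto `K`. -/
def IsModelTranslation (K : Set (FOPointed.{u} L)) (T : 𝔏.Pointed → FOPointed.{u} L) : Prop :=
  Set.BijOn T Set.univ K

/-- Truth-preserving pair of translations. -/
def TruthPreserving (Tf : 𝔏.Form → L.Formula Unit) (T : 𝔏.Pointed → FOPointed.{u} L) : Prop :=
  ∀ (φ : 𝔏.Form) (P : 𝔏.Pointed), 𝔏.Sat P.1 P.2 φ ↔ (T P).Models (Tf φ)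

/-- A notion of simulation, given by the predicate `Sim` singling out the relations that are
simulations, is an `𝔏`-simulation notion if every simulation is nonempty and preserves truth of
`𝔏`-formulas from left to right. -/
def IsSimulationNotion (Sim : (𝔏.Pointed → 𝔏.Pointed → Prop) → Prop) : Prop :=
  ∀ Z, Sim Z → (∃ P Q, Z P Q) ∧ ∀ P Q, Z P Q → 𝔏.Th P ⊆ 𝔏.Th Q

/-- There is a simulation linking the pointed model `P` to `Q`. -/
def IsSimilarTo (Sim : (𝔏.Pointed → 𝔏.Pointed → Prop) → Prop) (P Q : 𝔏.Pointed) : Prop :=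
  ∃ Z, Sim Z ∧ Z P Q

/-- The Hennessy–Milner property of a class of pointed models. -/
def HennessyMilner (Sim : (𝔏.Pointed → 𝔏.Pointed → Prop) → Prop) (C : Set 𝔏.Pointed) : Prop :=
  ∀ P ∈ C, ∀ Q ∈ C, 𝔏.Th P ⊆ 𝔏.Th Q → IsSimilarTo 𝔏 Sim P Q

/-- `⟨𝔏, K⟩` is an adequate pair by means of the translations `Tf`, `T` and the simulation
notion `Sim`. A pointed `𝔏`-model is `ω`-saturated when its translation is. -/
structure IsAdequatePair (K : Set (FOPointed.{u} L)) (Tf : 𝔏.Form → L.Formula Unit)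
    (T : 𝔏.Pointed → FOPointed.{u} L) (Sim : (𝔏.Pointed → 𝔏.Pointed → Prop) → Prop) : Prop where
  closed : ClosedUnderUltraproducts K
  formula_translation : IsFormulaTranslation 𝔏 Tf
  model_translation : IsModelTranslation 𝔏 K T
  truth_preserving : TruthPreserving 𝔏 Tf T
  simulation : IsSimulationNotion 𝔏 Sim
  hennessy_milner : HennessyMilner 𝔏 Sim {P | FOModel.OmegaSaturated (T P).1}

/-- `α(x)` is invariant for `𝔏`-simulations. -/
def SimulationInvariant (T : 𝔏.Pointed → FOPointed.{u} L)
    (Sim : (𝔏.Pointed → 𝔏.Pointed → Prop) → Prop) (α : L.Formula Unit) : Prop :=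
  ∀ P Q, IsSimilarTo 𝔏 Sim P Q → (T P).Models α → (T Q).Models α

/-- A class of pointed models is closed under simulations. -/
def ClosedUnderSimulations (Sim : (𝔏.Pointed → 𝔏.Pointed → Prop) → Prop)
    (M : Set 𝔏.Pointed) : Prop :=
  ∀ P ∈ M, ∀ Q, IsSimilarTo 𝔏 Sim P Q → Q ∈ M

/-- A class of pointed models is definable by a set of `𝔏`-formulas. -/
def DefinableBySet (M : Set 𝔏.Pointed) : Prop :=
  ∃ Γ : Set 𝔏.Form, ∀ P : 𝔏.Pointed, P ∈ M ↔ ∀ φ ∈ Γ, 𝔏.Sat P.1 P.2 φ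

/-- A class of pointed models is definable by a single `𝔏`-formula. -/
def DefinableByFormula (M : Set 𝔏.Pointed) : Prop :=
  ∃ φ : 𝔏.Form, ∀ P : 𝔏.Pointed, P ∈ M ↔ 𝔏.Sat P.1 P.2 φ

end Framework

/-! ### Memory logics -/

/-- The operators of the family of memory logics. -/
inductive MemOp
  | known
  | remember
  | forget
  | erase
  | diamond
  | doubleDiamond

/-- A memory logic is a set of operators containing at least `known` and `remember`. -/
structure MemoryLogic where
  ops : Set MemOp
  known_mem : MemOp.known ∈ ops
  remember_mem : MemOp.remember ∈ ops

/-- The formulas of a memory logic: propositional calculus together with its operators. -/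
inductive MemFormula (𝔏 : MemoryLogic) : Type
  | var (i : ℕ)
  | verum
  | falsum
  | neg (φ : MemFormula 𝔏)
  | conj (φ ψ : MemFormula 𝔏)
  | disj (φ ψ : MemFormula 𝔏)
  | imp (φ ψ : MemFormula 𝔏)
  | iff (φ ψ : MemFormula 𝔏)
  | known (h : MemOp.known ∈ 𝔏.ops)
  | remember (h : MemOp.remember ∈ 𝔏.ops) (φ : MemFormula 𝔏)
  | forget (h : MemOp.forget ∈ 𝔏.ops) (φ : MemFormula 𝔏)
  | erase (h : MemOp.erase ∈ 𝔏.ops) (φ : MemFormula 𝔏)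
  | diamond (h : MemOp.diamond ∈ 𝔏.ops) (φ : MemFormula 𝔏)
  | doubleDiamond (h : MemOp.doubleDiamond ∈ 𝔏.ops) (φ : MemFormula 𝔏)

/-- A memory model `⟨W, R, V, S⟩`. -/
structure MemModel where
  W : Type u
  nonempty : Nonempty W
  R : W → W → Prop
  V : ℕ → Set W
  S : Set W

/-- `M[+w]`. -/
def MemModel.remember (M : MemModel.{u}) (w : M.W) : MemModel.{u} :=
  { M with S := M.S ∪ {w} }

/-- `M[-w]`. -/
def MemModel.forget (M : MemModel.{u}) (w : M.W) : MemModel.{u} :=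
  { M with S := M.S \ {w} }

/-- `M[*]`. -/
def MemModel.erase (M : MemModel.{u}) : MemModel.{u} :=
  { M with S := ∅ }

/-- Truth of a formula at a point of a memory model. -/
def MemFormula.Sat {𝔏 : MemoryLogic} : MemFormula 𝔏 → (M : MemModel.{u}) → M.W → Prop
  | .var i, M, w => w ∈ M.V i
  | .verum, _, _ => True
  | .falsum, _, _ => False
  | .neg φ, M, w => ¬ φ.Sat M w
  | .conj φ ψ, M, w => φ.Sat M w ∧ ψ.Sat M w
  | .disj φ ψ, M, w => φ.Sat M w ∨ ψ.Sat M w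
  | .imp φ ψ, M, w => φ.Sat M w → ψ.Sat M w
  | .iff φ ψ, M, w => (φ.Sat M w ↔ ψ.Sat M w)
  | .known _, M, w => w ∈ M.S
  | .remember _ φ, M, w => φ.Sat (M.remember w) w
  | .forget _ φ, M, w => φ.Sat (M.forget w) w
  | .erase _ φ, M, w => φ.Sat M.erase w
  | .diamond _ φ, M, w => ∃ w' : M.W, M.R w w' ∧ φ.Sat M w'
  | .doubleDiamond _ φ, M, w => ∃ w' : M.W, M.R w w' ∧ φ.Sat (M.remember w) w'

/-- A memory logic as a source logic. -/
abbrev MemoryLogic.source (𝔏 : MemoryLogic) : SourceLogic.{u} where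
  Form := MemFormula 𝔏
  Model := MemModel.{u}
  World := MemModel.W
  nonempty_world := MemModel.nonempty
  val := MemModel.V
  Sat := fun M w φ => φ.Sat M w
  var := .var
  verum := .verum
  falsum := .falsum
  conj := .conj
  disj := .disj
  sat_var := fun _ _ _ => Iff.rfl
  sat_verum := fun _ _ => trivial
  sat_falsum := fun _ _ h => h
  sat_conj := fun _ _ _ _ => Iff.rfl
  sat_disj := fun _ _ _ _ => Iff.rfl

/-- Relation symbols of the target signature: unary `P i` (`i : ℕ`) and `K`, binary `R`. -/
inductive MemRel : ℕ → Type
  | P (i : ℕ) : MemRel 1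
  | K : MemRel 1
  | R : MemRel 2

/-- The target first-order signature (with equality, as always in Mathlib). -/
def memLang : FirstOrder.Language.{0, 0} where
  Functions := fun _ => Empty
  Relations := MemRel

/-- Interpretation of the relation symbols in a memory model. -/
def MemModel.relMap (M : MemModel.{u}) : {n : ℕ} → MemRel n → (Fin n → M.W) → Prop
  | _, .P i, a => a 0 ∈ M.V i
  | _, .K, a => a 0 ∈ M.S
  | _, .R, a => M.R (a 0) (a 1)

/-- The first-order structure of a memory model. -/
@[reducible] def MemModel.foStructure (M : MemModel.{u}) : memLang.Structure M.W where
  funMap := fun f _ => Empty.elim f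
  RelMap := fun r a => M.relMap r a

/-- The first-order model of a memory model. -/
abbrev MemModel.toFO (M : MemModel.{u}) : FOModel.{u} memLang :=
  letI : memLang.Structure M.W := M.foStructure
  haveI : Nonempty M.W := M.nonempty
  FirstOrder.Language.Theory.ModelType.of ∅ M.W

/-- The model translation of memory logics. -/
def memModelTranslation (𝔏 : MemoryLogic) (P : 𝔏.source.Pointed) : FOPointed.{u} memLang :=
  ⟨P.1.toFO, fun _ => (P.2 : P.1.W)⟩

/-- Pointed memory models. -/
abbrev MemPointed : Type (u + 1) := Σ M : MemModel.{u}, M.W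

/-- The simulations for the memory logic `𝔏`: the conditions that are always required and those
of the operators of `𝔏`. -/
structure IsMemSimulation (𝔏 : MemoryLogic) (Z : MemPointed.{u} → MemPointed.{u} → Prop) :
    Prop where
  nontriv : ∃ P Q, Z P Q
  agree : ∀ (M N : MemModel.{u}) (m : M.W) (n : N.W), Z ⟨M, m⟩ ⟨N, n⟩ →
    ∀ i, m ∈ M.V i ↔ n ∈ N.V i
  kagree : MemOp.known ∈ 𝔏.ops → ∀ (M N : MemModel.{u}) (m : M.W) (n : N.W), Z ⟨M, m⟩ ⟨N, n⟩ →
    (m ∈ M.S ↔ n ∈ N.S)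
  remember : MemOp.remember ∈ 𝔏.ops → ∀ (M N : MemModel.{u}) (m : M.W) (n : N.W),
    Z ⟨M, m⟩ ⟨N, n⟩ → Z ⟨M.remember m, m⟩ ⟨N.remember n, n⟩
  forget : MemOp.forget ∈ 𝔏.ops → ∀ (M N : MemModel.{u}) (m : M.W) (n : N.W),
    Z ⟨M, m⟩ ⟨N, n⟩ → Z ⟨M.forget m, m⟩ ⟨N.forget n, n⟩
  erase : MemOp.erase ∈ 𝔏.ops → ∀ (M N : MemModel.{u}) (m : M.W) (n : N.W),
    Z ⟨M, m⟩ ⟨N, n⟩ → Z ⟨M.erase, m⟩ ⟨N.erase, n⟩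
  forth : MemOp.diamond ∈ 𝔏.ops → ∀ (M N : MemModel.{u}) (m : M.W) (n : N.W),
    Z ⟨M, m⟩ ⟨N, n⟩ → ∀ m', M.R m m' → ∃ n', N.R n n' ∧ Z ⟨M, m'⟩ ⟨N, n'⟩
  back : MemOp.diamond ∈ 𝔏.ops → ∀ (M N : MemModel.{u}) (m : M.W) (n : N.W),
    Z ⟨M, m⟩ ⟨N, n⟩ → ∀ n', N.R n n' → ∃ m', M.R m m' ∧ Z ⟨M, m'⟩ ⟨N, n'⟩
  mforth : MemOp.doubleDiamond ∈ 𝔏.ops → ∀ (M N : MemModel.{u}) (m : M.W) (n : N.W),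
    Z ⟨M, m⟩ ⟨N, n⟩ → ∀ m', M.R m m' → ∃ n', N.R n n' ∧ Z ⟨M.remember m, m'⟩ ⟨N.remember n, n'⟩
  mback : MemOp.doubleDiamond ∈ 𝔏.ops → ∀ (M N : MemModel.{u}) (m : M.W) (n : N.W),
    Z ⟨M, m⟩ ⟨N, n⟩ → ∀ n', N.R n n' → ∃ m', M.R m m' ∧ Z ⟨M.remember m, m'⟩ ⟨N.remember n, n'⟩

/-- The simulation notion of the source logic of `𝔏`. -/
def memSimulation (𝔏 : MemoryLogic)
    (Z : 𝔏.source.Pointed → (SourceLogic.Pointed.{u} 𝔏.source) → Prop) : Prop :=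
  IsMemSimulation.{u} 𝔏 Z

/-! ### Łoś's theorem and saturation of ultraproducts -/

section Ultraproducts

variable {L : FirstOrder.Language.{0, 0}}

/-! The definability results are proved once for adequate pairs, by a detour through ultrapowers. If
the class $\mathsf M$ and a point $Q$ satisfying every formula valid on $\mathsf M$ are given, an
ultraproduct of members of $\mathsf M$ has its theory included in $\mathrm{Th}(Q)$. If $Q$ were
outside $\mathsf M$, this ultraproduct and $Q$ could be replaced by $\omega$-saturated ultrapowers,
one inside and one outside $\mathsf M$; the Hennessy–Milner property then gives a simulation between
them, against closure under simulations (`IsAdequatePair.definableBySet_of_closed`). A compactness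
argument cuts the defining set down to one formula, and the characterization is this result applied
to the class of models of $\alpha$.

What remains is adequacy of memory logics. Memory changes during evaluation, so the translation
carries the current memory as a first-order formula $\kappa(y)$ with parameters
(`MemFormula.exists_translation`). For the same reason, Hennessy–Milner is proved on the models
obtained from $\omega$-saturated ones by making the memory definable with parameters: this class is
stable under all memory operations, and on it equality of theories is a simulation
(`SaturatedEquiv.isMemSimulation`). -/

theorem FOPointed.models_ultraproduct {I : Type u} (U : Ultrafilter I)
    (P : I → FOPointed.{u} L) (α : L.Formula Unit) :
    (FOPointed.ultraproduct U P).Models α ↔ ∀ᶠ i in (U : Filter I), (P i).Models α :=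
  FirstOrder.Language.Ultraproduct.realize_formula_cast (u := U)
    (M := fun i => ((P i).1 : Type u)) α (fun x i => (P i).2 x)

/-- A countable set of formulas that is finitely realizable in an ultraproduct along a countably
incomplete ultrafilter is realized there. -/
theorem FOModel.exists_realize_ultraproduct (U : Ultrafilter (ULift.{u} ℕ))
    (hU : ∀ n : ℕ, ∀ᶠ i in (U : Filter (ULift.{u} ℕ)), n ≤ i.down)
    (M : ULift.{u} ℕ → FOModel.{u} L) {β : Type u} (v : β → FOModel.ultraproduct U M)
    (γ : ℕ → L.Formula (β ⊕ Unit))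
    (h : ∀ n, ∃ w : FOModel.ultraproduct U M, ∀ k < n, (γ k).Realize (Sum.elim v fun _ => w)) :
    ∃ w : FOModel.ultraproduct U M, ∀ k, (γ k).Realize (Sum.elim v fun _ => w) := by
  classical
  have hlift : ∀ b, ∃ a : ∀ i, M i,
      v b = (a : (U : Filter (ULift.{u} ℕ)).Product fun i => (M i : Type u)) :=
    fun b => ⟨Quotient.out (v b), (Quotient.out_eq (v b)).symm⟩
  choose a ha using hlift
  have los : ∀ (φ : L.Formula (β ⊕ Unit)) (w : ∀ i, M i),
      (φ.Realize (Sum.elim v fun _ =>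
        (w : (U : Filter (ULift.{u} ℕ)).Product fun i => (M i : Type u))) ↔
      ∀ᶠ i in (U : Filter (ULift.{u} ℕ)), φ.Realize (Sum.elim (fun b => a b i) fun _ => w i)) := by
    intro φ w
    have h1 : (Sum.elim v fun _ : Unit =>
        (w : (U : Filter (ULift.{u} ℕ)).Product fun i => (M i : Type u))) =
        fun s => ((Sum.elim a (fun _ => w) s : ∀ i, M i) :
          (U : Filter (ULift.{u} ℕ)).Product fun i => (M i : Type u)) := by
      funext s
      rcases s with b | _
      · exact ha b
      · rfl
    have h2 : ∀ i, (Sum.elim (fun b => a b i) fun _ => w i : β ⊕ Unit → M i) =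
        fun s => (Sum.elim a (fun _ => w) s : ∀ i, M i) i := by
      intro i
      funext s
      rcases s with b | _ <;> rfl
    simp only [h1, h2]
    exact FirstOrder.Language.Ultraproduct.realize_formula_cast (u := U)
      (M := fun i => (M i : Type u)) φ (Sum.elim a fun _ => w)
  let p : ∀ i : ULift.{u} ℕ, ℕ → Prop := fun i n =>
    ∃ w : M i, ∀ k < n, (γ k).Realize (Sum.elim (fun b => a b i) fun _ => w)
  -- The case 0 makes the default value of `Nat.findGreatest` satisfy `p i` as well.
  have hp0 : ∀ i, p i 0 := fun i =>
    ⟨Classical.arbitrary _, fun k hk => absurd hk (Nat.not_lt_zero k)⟩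
  have hp : ∀ n, ∀ᶠ i in (U : Filter (ULift.{u} ℕ)), p i n := by
    intro n
    obtain ⟨w, hw⟩ := h n
    obtain ⟨w, rfl⟩ : ∃ w' : ∀ i, M i,
        (w' : (U : Filter (ULift.{u} ℕ)).Product fun i => (M i : Type u)) = w :=
      ⟨Quotient.out w, Quotient.out_eq w⟩
    have : ∀ᶠ i in (U : Filter (ULift.{u} ℕ)), ∀ k ∈ Set.Iio n,
        (γ k).Realize (Sum.elim (fun b => a b i) fun _ => w i) :=
      (Filter.eventually_all_finite (Set.finite_Iio n)).2 fun k hk => (los _ _).1 (hw k hk)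
    exact this.mono fun i hi => ⟨w i, hi⟩
  -- Diagonal choice: in factor `i`, realize the longest realizable initial segment of length at
  -- most `i`. For fixed `k` this length exceeds `k` for almost all `i`.
  have hw : ∀ i, ∃ w : M i, ∀ k < Nat.findGreatest (p i) i.down,
      (γ k).Realize (Sum.elim (fun b => a b i) fun _ => w) := fun i =>
    Nat.findGreatest_spec (P := p i) (Nat.zero_le _) (hp0 i)
  choose w hw using hw
  refine ⟨(w : (U : Filter (ULift.{u} ℕ)).Product fun i => (M i : Type u)), fun k => ?_⟩
  refine (los _ _).2 ?_
  filter_upwards [hU (k + 1), hp (k + 1)] with i h1 h2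
  exact hw i k (Nat.le_findGreatest h1 h2)

/-- A countable language with finitely many added constants has countably many formulas, so a type
can be enumerated; the constants are turned back into variables before the diagonal argument is
applied. -/
theorem FOModel.omegaSaturated_ultraproduct [Countable L.Symbols] (U : Ultrafilter (ULift.{u} ℕ))
    (hU : ∀ n : ℕ, ∀ᶠ i in (U : Filter (ULift.{u} ℕ)), n ≤ i.down)
    (M : ULift.{u} ℕ → FOModel.{u} L) : (FOModel.ultraproduct U M).OmegaSaturated := by
  intro A hA Γ hΓ
  have : Countable A := hA.countable
  have tr : ∀ (φ : (L[[A]]).Formula Unit) (w : FOModel.ultraproduct U M),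
      FirstOrder.Language.Formula.Realize (L := L)
        (FirstOrder.Language.BoundedFormula.constantsVarsEquiv φ)
        (Sum.elim (fun b : A => (b : FOModel.ultraproduct U M)) fun _ => w) ↔
      φ.Realize (fun _ => w) := fun φ w =>
    FirstOrder.Language.BoundedFormula.realize_constantsVarsEquiv
  rcases Γ.eq_empty_or_nonempty with rfl | hne
  · exact ⟨Classical.arbitrary _, by simp⟩
  obtain ⟨f, rfl⟩ := (Set.to_countable Γ).exists_eq_range hne
  obtain ⟨w, hw⟩ := FOModel.exists_realize_ultraproduct U hU M
    (fun b : A => (b : FOModel.ultraproduct U M))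
    (fun k => FirstOrder.Language.BoundedFormula.constantsVarsEquiv (f k)) (by
      intro n
      obtain ⟨w, hw⟩ := hΓ (f '' Set.Iio n) (Set.image_subset_range _ _)
        ((Set.finite_Iio n).image f)
      exact ⟨w, fun k hk => (tr _ _).2 (hw _ ⟨k, hk, rfl⟩)⟩)
  exact ⟨w, by rintro _ ⟨k, rfl⟩; exact (tr _ _).1 (hw k)⟩

/-- The lift puts the index set in the universe over which closure under ultrapowers quantifies. -/
theorem exists_ultrafilter_ulift_nat : ∃ U : Ultrafilter (ULift.{u} ℕ),
    ∀ n : ℕ, ∀ᶠ i in (U : Filter (ULift.{u} ℕ)), n ≤ i.down := by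
  refine ⟨Ultrafilter.map ULift.up (Ultrafilter.of Filter.atTop), fun n => ?_⟩
  exact Ultrafilter.of_le Filter.atTop (Filter.eventually_ge_atTop n)

/-- Saturation with parameters given by a finite tuple instead of a finite set of constants. -/
theorem FOModel.OmegaSaturated.exists_realize {M : FOModel.{u} L} (hM : M.OmegaSaturated)
    {β : Type} [Finite β] (v : β → M) (Γ : Set (L.Formula (β ⊕ Unit)))
    (h : ∀ Δ ⊆ Γ, Δ.Finite → ∃ w : M, ∀ φ ∈ Δ, φ.Realize (Sum.elim v fun _ => w)) :
    ∃ w : M, ∀ φ ∈ Γ, φ.Realize (Sum.elim v fun _ => w) := by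
  let A : Set M := Set.range v
  let e : L.Formula (β ⊕ Unit) → (L[[A]]).Formula Unit := fun φ =>
    FirstOrder.Language.BoundedFormula.constantsVarsEquiv.symm
      (φ.relabel (Sum.map (fun b => (⟨v b, b, rfl⟩ : A)) id))
  have he : ∀ (φ : L.Formula (β ⊕ Unit)) (w : M),
      (e φ).Realize (fun _ => w) ↔ φ.Realize (Sum.elim v fun _ => w) := by
    intro φ w
    have := FirstOrder.Language.BoundedFormula.realize_constantsVarsEquiv (L := L) (α := A)
      (M := M) (φ := e φ) (v := fun _ : Unit => w) (xs := default)
    refine this.symm.trans ?_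
    simp only [e, Equiv.apply_symm_apply]
    refine (FirstOrder.Language.Formula.realize_relabel (M := M)
      (v := Sum.elim (fun a : A => (a : M)) fun _ => w)).trans ?_
    rw [Sum.elim_comp_map]
    rfl
  obtain ⟨w, hw⟩ := hM A (Set.finite_range v) (e '' Γ) (by
    intro Δ hΔ hfin
    obtain ⟨Δ', hsub, hfin', rfl⟩ : ∃ Δ' ⊆ Γ, Δ'.Finite ∧ Δ = e '' Δ' :=
      Set.exists_subset_image_finite_and.1 ⟨Δ, hΔ, hfin, rfl⟩
    obtain ⟨w, hw⟩ := h Δ' hsub hfin'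
    exact ⟨w, by rintro _ ⟨φ, hφ, rfl⟩; exact (he _ _).2 (hw φ hφ)⟩)
  exact ⟨w, fun φ hφ => (he _ _).1 (hw _ ⟨φ, hφ, rfl⟩)⟩

end Ultraproducts

/-! ### Characterization and definability for adequate pairs -/

section AdequatePair

variable {𝔏 : SourceLogic.{u}} {L : FirstOrder.Language.{0, 0}} {K : Set (FOPointed.{u} L)}
  {Tf : 𝔏.Form → L.Formula Unit} {T : 𝔏.Pointed → FOPointed.{u} L}
  {Sim : (𝔏.Pointed → 𝔏.Pointed → Prop) → Prop}

theorem SourceLogic.exists_finset_disj (𝔏 : SourceLogic.{u}) (Δ : Finset 𝔏.Form) :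
    ∃ ψ : 𝔏.Form, ∀ P : 𝔏.Pointed, 𝔏.Sat P.1 P.2 ψ ↔ ∃ φ ∈ Δ, 𝔏.Sat P.1 P.2 φ := by
  classical
  induction Δ using Finset.induction_on with
  | empty => exact ⟨𝔏.falsum, fun P => by simp [𝔏.sat_falsum]⟩
  | insert φ Δ _ ih =>
    obtain ⟨ψ, hψ⟩ := ih
    exact ⟨𝔏.disj φ ψ, fun P => by simp [𝔏.sat_disj, hψ]⟩

theorem SourceLogic.exists_finset_conj (𝔏 : SourceLogic.{u}) (Δ : Finset 𝔏.Form) :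
    ∃ ψ : 𝔏.Form, ∀ P : 𝔏.Pointed, 𝔏.Sat P.1 P.2 ψ ↔ ∀ φ ∈ Δ, 𝔏.Sat P.1 P.2 φ := by
  classical
  induction Δ using Finset.induction_on with
  | empty => exact ⟨𝔏.verum, fun P => by simp [𝔏.sat_verum]⟩
  | insert φ Δ _ ih =>
    obtain ⟨ψ, hψ⟩ := ih
    exact ⟨𝔏.conj φ ψ, fun P => by simp [𝔏.sat_conj, hψ]⟩

/-- Łoś's theorem for a source logic with a truth-preserving translation. -/
theorem TruthPreserving.sat_of_eq_ultraproduct (hT : TruthPreserving 𝔏 Tf T) {I : Type u}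
    {U : Ultrafilter I} {P : I → 𝔏.Pointed} {Q : 𝔏.Pointed}
    (hQ : T Q = FOPointed.ultraproduct U fun i => T (P i)) (φ : 𝔏.Form) :
    𝔏.Sat Q.1 Q.2 φ ↔ ∀ᶠ i in (U : Filter I), 𝔏.Sat (P i).1 (P i).2 φ := by
  rw [hT φ Q, hQ, FOPointed.models_ultraproduct]
  simp only [hT φ]

/-- A compactness principle: a class whose translation is closed under ultraproducts contains
a limit of any family of its members indexed by the finite subsets of a set of formulas. -/
theorem TruthPreserving.exists_limit (hT : TruthPreserving 𝔏 Tf T) {C : Set 𝔏.Pointed}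
    (hC : ClosedUnderUltraproducts (T '' C)) (G : Set 𝔏.Form) (P : Finset G → 𝔏.Pointed)
    (hP : ∀ Δ, P Δ ∈ C) :
    ∃ Q ∈ C, ∀ φ : G,
      ((∀ Δ, φ ∈ Δ → 𝔏.Sat (P Δ).1 (P Δ).2 φ) → 𝔏.Sat Q.1 Q.2 φ) ∧
      ((∀ Δ, φ ∈ Δ → ¬ 𝔏.Sat (P Δ).1 (P Δ).2 φ) → ¬ 𝔏.Sat Q.1 Q.2 φ) := by
  let U : Ultrafilter (ULift.{u} (Finset G)) :=
    Ultrafilter.map ULift.up (Ultrafilter.of Filter.atTop)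
  -- `U` extends the filter of cones of finite sets, so almost every index contains a given formula.
  have hU : ∀ φ : G, ∀ᶠ i in (U : Filter (ULift.{u} (Finset G))), φ ∈ i.down := fun φ =>
    Ultrafilter.of_le Filter.atTop
      ((Filter.eventually_ge_atTop {φ}).mono fun Δ h => h (Finset.mem_singleton_self φ))
  obtain ⟨Q, hQC, hQ⟩ := hC _ U (fun i => T (P i.down)) fun i => ⟨_, hP i.down, rfl⟩
  refine ⟨Q, hQC, fun φ => ⟨fun h => ?_, fun h => ?_⟩⟩
  · rw [hT.sat_of_eq_ultraproduct hQ]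
    exact (hU φ).mono fun i hi => h _ hi
  · rw [hT.sat_of_eq_ultraproduct hQ, ← Ultrafilter.eventually_not]
    exact (hU φ).mono fun i hi => h _ hi

theorem ClosedUnderUltraproducts.closedUnderUltrapowers {C : Set (FOPointed.{u} L)}
    (hC : ClosedUnderUltraproducts C) : ClosedUnderUltrapowers C :=
  fun I U P hP => hC I U (fun _ => P) fun _ => hP

/-- A class whose translation is closed under ultrapowers contains an `ω`-saturated pointed model
with the same theory as any given member. -/
theorem TruthPreserving.exists_omegaSaturated [Countable L.Symbols] (hT : TruthPreserving 𝔏 Tf T)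
    {C : Set 𝔏.Pointed} (hC : ClosedUnderUltrapowers (T '' C)) {P : 𝔏.Pointed} (hP : P ∈ C) :
    ∃ Q ∈ C, (T Q).1.OmegaSaturated ∧ 𝔏.Th Q = 𝔏.Th P := by
  obtain ⟨U, hU⟩ := exists_ultrafilter_ulift_nat.{u}
  obtain ⟨Q, hQC, hQ⟩ := hC _ U (T P) ⟨P, hP, rfl⟩
  refine ⟨Q, hQC, ?_, ?_⟩
  · rw [hQ]
    exact FOModel.omegaSaturated_ultraproduct U hU _
  · ext φ
    exact (hT.sat_of_eq_ultraproduct (P := fun _ => P) hQ φ).trans Filter.eventually_const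

/-! ### Closure conditions versus definability -/

theorem IsAdequatePair.closedUnderSimulations_of_definableBySet
    (h : IsAdequatePair 𝔏 K Tf T Sim) {M : Set 𝔏.Pointed} (hM : DefinableBySet 𝔏 M) :
    ClosedUnderSimulations 𝔏 Sim M := by
  obtain ⟨Γ, hΓ⟩ := hM
  rintro P hP Q ⟨Z, hZ, hPQ⟩
  exact (hΓ Q).2 fun φ hφ => (h.simulation Z hZ).2 P Q hPQ ((hΓ P).1 hP φ hφ)

theorem IsAdequatePair.exists_eq_ultraproduct (h : IsAdequatePair 𝔏 K Tf T Sim) {I : Type u}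
    (U : Ultrafilter I) (P : I → 𝔏.Pointed) :
    ∃ Q, T Q = FOPointed.ultraproduct U fun i => T (P i) := by
  obtain ⟨Q, -, hQ⟩ := h.model_translation.surjOn
    (h.closed I U (fun i => T (P i)) fun i => h.model_translation.mapsTo (Set.mem_univ _))
  exact ⟨Q, hQ⟩

theorem IsAdequatePair.closedUnderUltraproducts_of_definableBySet
    (h : IsAdequatePair 𝔏 K Tf T Sim) {M : Set 𝔏.Pointed} (hM : DefinableBySet 𝔏 M) :
    ClosedUnderUltraproducts (T '' M) := by
  obtain ⟨Γ, hΓ⟩ := hM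
  intro I U P hP
  choose P' hP' hP using hP
  obtain rfl : (fun i => T (P' i)) = P := funext hP
  obtain ⟨Q, hQ⟩ := h.exists_eq_ultraproduct U P'
  exact ⟨Q, (hΓ Q).2 fun φ hφ => (h.truth_preserving.sat_of_eq_ultraproduct hQ φ).2
    (Filter.Eventually.of_forall fun i => (hΓ _).1 (hP' i) φ hφ), hQ⟩

/-- An ultrapower has the same theory as its factor, so it cannot enter a class defined by formulas.
With varying factors outside the class, different formulas of the set may fail in different factors;
this is why only ultrapowers appear. -/
theorem IsAdequatePair.closedUnderUltrapowers_compl_of_definableBySet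
    (h : IsAdequatePair 𝔏 K Tf T Sim) {M : Set 𝔏.Pointed} (hM : DefinableBySet 𝔏 M) :
    ClosedUnderUltrapowers (T '' Mᶜ) := by
  obtain ⟨Γ, hΓ⟩ := hM
  rintro I U _ ⟨P, hP, rfl⟩
  obtain ⟨Q, hQ⟩ := h.exists_eq_ultraproduct U fun _ => P
  refine ⟨Q, fun hQM => hP ((hΓ P).2 fun φ hφ => ?_), hQ⟩
  simpa using (h.truth_preserving.sat_of_eq_ultraproduct hQ φ).1 ((hΓ Q).1 hQM φ hφ)

theorem IsAdequatePair.definableBySet_of_closed [Countable L.Symbols]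
    (h : IsAdequatePair 𝔏 K Tf T Sim) {M : Set 𝔏.Pointed} (hsim : ClosedUnderSimulations 𝔏 Sim M)
    (hM : ClosedUnderUltraproducts (T '' M)) (hM' : ClosedUnderUltrapowers (T '' Mᶜ)) :
    DefinableBySet 𝔏 M := by
  refine ⟨{φ | ∀ P ∈ M, 𝔏.Sat P.1 P.2 φ}, fun Q => ⟨fun hQ φ hφ => hφ Q hQ, fun hQ => ?_⟩⟩
  -- Otherwise the disjunction of `Δ` would be valid on `M`, hence true at `Q`, although each
  -- disjunct is false there.
  have hfin : ∀ Δ : Finset ((𝔏.Th Q)ᶜ : Set 𝔏.Form), ∃ P ∈ M, ∀ φ ∈ Δ, ¬ 𝔏.Sat P.1 P.2 φ := by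
    intro Δ
    by_contra! hcon
    obtain ⟨ψ, hψ⟩ := 𝔏.exists_finset_disj (Δ.map (Function.Embedding.subtype _))
    obtain ⟨φ, hφ, hsat⟩ := (hψ Q).1 (hQ ψ fun P hP => (hψ P).2 (by
      obtain ⟨φ, hφ, hsat⟩ := hcon P hP
      exact ⟨φ, Finset.mem_map_of_mem _ hφ, hsat⟩))
    obtain ⟨φ', -, rfl⟩ := Finset.mem_map.1 hφ
    exact φ'.2 hsat
  choose P hPM hP using hfin
  obtain ⟨P', hP'M, hP'⟩ := h.truth_preserving.exists_limit hM _ P hPM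
  have hth : 𝔏.Th P' ⊆ 𝔏.Th Q := fun φ hφ => by
    by_contra hcon
    exact (hP' ⟨φ, hcon⟩).2 (fun Δ hΔ => hP Δ _ hΔ) hφ
  by_contra hQM
  obtain ⟨P₁, hP₁M, hP₁, hP₁th⟩ :=
    h.truth_preserving.exists_omegaSaturated hM.closedUnderUltrapowers hP'M
  obtain ⟨Q₁, hQ₁M, hQ₁, hQ₁th⟩ := h.truth_preserving.exists_omegaSaturated hM' hQM
  exact hQ₁M (hsim P₁ hP₁M Q₁ (h.hennessy_milner P₁ hP₁ Q₁ hQ₁ (by rwa [hP₁th, hQ₁th])))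

theorem IsAdequatePair.definableBySet_iff [Countable L.Symbols]
    (h : IsAdequatePair 𝔏 K Tf T Sim) (M : Set 𝔏.Pointed) :
    DefinableBySet 𝔏 M ↔ ClosedUnderSimulations 𝔏 Sim M ∧
      ClosedUnderUltraproducts (T '' M) ∧ ClosedUnderUltrapowers (T '' Mᶜ) :=
  ⟨fun hM => ⟨h.closedUnderSimulations_of_definableBySet hM,
      h.closedUnderUltraproducts_of_definableBySet hM,
      h.closedUnderUltrapowers_compl_of_definableBySet hM⟩,
    fun ⟨h1, h2, h3⟩ => h.definableBySet_of_closed h1 h2 h3⟩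

theorem DefinableByFormula.definableBySet {M : Set 𝔏.Pointed} (hM : DefinableByFormula 𝔏 M) :
    DefinableBySet 𝔏 M := by
  obtain ⟨φ, hφ⟩ := hM
  exact ⟨{φ}, fun P => by simpa using hφ P⟩

theorem IsAdequatePair.closedUnderUltraproducts_compl_of_definableByFormula
    (h : IsAdequatePair 𝔏 K Tf T Sim) {M : Set 𝔏.Pointed} (hM : DefinableByFormula 𝔏 M) :
    ClosedUnderUltraproducts (T '' Mᶜ) := by
  obtain ⟨φ, hφ⟩ := hM
  intro I U P hP
  choose P' hP' hP using hP
  obtain rfl : (fun i => T (P' i)) = P := funext hP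
  obtain ⟨Q, hQ⟩ := h.exists_eq_ultraproduct U P'
  refine ⟨Q, fun hQM => ?_, hQ⟩
  obtain ⟨i, hi⟩ := ((h.truth_preserving.sat_of_eq_ultraproduct hQ φ).1 ((hφ Q).1 hQM)).exists
  exact hP' i ((hφ _).2 hi)

/-- If no finite conjunction from the defining set `Γ` defines `M`, each finite part of `Γ` holds at
some point outside `M`. A limit of these points stays outside `M` yet satisfies all of `Γ`. -/
theorem IsAdequatePair.definableByFormula_of_closed [Countable L.Symbols]
    (h : IsAdequatePair 𝔏 K Tf T Sim) {M : Set 𝔏.Pointed} (hsim : ClosedUnderSimulations 𝔏 Sim M)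
    (hM : ClosedUnderUltraproducts (T '' M)) (hM' : ClosedUnderUltraproducts (T '' Mᶜ)) :
    DefinableByFormula 𝔏 M := by
  obtain ⟨Γ, hΓ⟩ := h.definableBySet_of_closed hsim hM hM'.closedUnderUltrapowers
  by_contra hcon
  have hfin : ∀ Δ : Finset Γ, ∃ P ∈ Mᶜ, ∀ φ ∈ Δ, 𝔏.Sat P.1 P.2 φ := by
    intro Δ
    by_contra! hΔ
    obtain ⟨ψ, hψ⟩ := 𝔏.exists_finset_conj (Δ.map (Function.Embedding.subtype _))
    refine hcon ⟨ψ, fun P => ⟨fun hP => (hψ P).2 fun φ hφ => ?_, fun hP => ?_⟩⟩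
    · obtain ⟨φ', -, rfl⟩ := Finset.mem_map.1 hφ
      exact (hΓ P).1 hP _ φ'.2
    · by_contra hPM
      obtain ⟨φ, hφ, hsat⟩ := hΔ P hPM
      exact hsat ((hψ P).1 hP φ (Finset.mem_map_of_mem _ hφ))
  choose P hPM hP using hfin
  obtain ⟨Q, hQM, hQ⟩ := h.truth_preserving.exists_limit hM' Γ P hPM
  exact hQM ((hΓ Q).2 fun φ hφ => (hQ ⟨φ, hφ⟩).1 fun Δ hΔ => hP Δ _ hΔ)

theorem IsAdequatePair.definableByFormula_iff [Countable L.Symbols]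
    (h : IsAdequatePair 𝔏 K Tf T Sim) (M : Set 𝔏.Pointed) :
    DefinableByFormula 𝔏 M ↔ ClosedUnderSimulations 𝔏 Sim M ∧
      ClosedUnderUltraproducts (T '' M) ∧ ClosedUnderUltraproducts (T '' Mᶜ) :=
  ⟨fun hM => ⟨h.closedUnderSimulations_of_definableBySet hM.definableBySet,
      h.closedUnderUltraproducts_of_definableBySet hM.definableBySet,
      h.closedUnderUltraproducts_compl_of_definableByFormula hM⟩,
    fun ⟨h1, h2, h3⟩ => h.definableByFormula_of_closed h1 h2 h3⟩

theorem IsAdequatePair.closedUnderUltraproducts_models (h : IsAdequatePair 𝔏 K Tf T Sim)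
    (α : L.Formula Unit) : ClosedUnderUltraproducts (T '' {P | (T P).Models α}) := by
  intro I U P hP
  choose P' hP' hP using hP
  obtain rfl : (fun i => T (P' i)) = P := funext hP
  obtain ⟨Q, hQ⟩ := h.exists_eq_ultraproduct U P'
  refine ⟨Q, ?_, hQ⟩
  rw [Set.mem_ofPred_eq, hQ, FOPointed.models_ultraproduct]
  exact Filter.Eventually.of_forall hP'

/-- Invariance of `α` is closure of its class of models under simulations; Łoś's theorem for `α` and
for `∼α` gives the two closures under ultraproducts. -/
theorem IsAdequatePair.exists_kEquivalent_iff [Countable L.Symbols]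
    (h : IsAdequatePair 𝔏 K Tf T Sim) (α : L.Formula Unit) :
    (∃ φ, KEquivalent K α (Tf φ)) ↔ SimulationInvariant 𝔏 T Sim α := by
  constructor
  · rintro ⟨φ, hφ⟩ P Q ⟨Z, hZ, hPQ⟩ hα
    have hmem : ∀ P, T P ∈ K := fun P => h.model_translation.mapsTo (Set.mem_univ P)
    rw [hφ _ (hmem _), ← h.truth_preserving] at hα ⊢
    exact (h.simulation Z hZ).2 P Q hPQ hα
  · intro hα
    obtain ⟨φ, hφ⟩ := h.definableByFormula_of_closed (M := {P | (T P).Models α})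
      (fun P hP Q hPQ => hα P Q hPQ hP) (h.closedUnderUltraproducts_models α) (by
        have : {P | (T P).Models α}ᶜ = {P | (T P).Models (∼α)} := by
          ext P
          simp [FOPointed.Models, FirstOrder.Language.Formula.realize_not]
        rw [this]
        exact h.closedUnderUltraproducts_models _)
    refine ⟨φ, fun A hA => ?_⟩
    obtain ⟨P, -, rfl⟩ := h.model_translation.surjOn hA
    exact (hφ P).trans (h.truth_preserving φ P)

end AdequatePair

/-! ### The model translation of memory logics -/

theorem Fin.eq_const_zero {α : Type*} (a : Fin 1 → α) : (fun _ => a 0) = a := by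
  funext i
  rw [Subsingleton.elim i 0]

/-- The memory model of a first-order model. -/
def MemModel.ofFO (A : FOModel.{u} memLang) : MemModel.{u} where
  W := A
  nonempty := A.nonempty'
  R a b := A.struc.RelMap MemRel.R ![a, b]
  V i := {a | A.struc.RelMap (MemRel.P i) fun _ => a}
  S := {a | A.struc.RelMap MemRel.K fun _ => a}

theorem MemModel.foStructure_ofFO (A : FOModel.{u} memLang) :
    (MemModel.ofFO A).foStructure = A.struc := by
  refine FirstOrder.Language.Structure.ext ?_ ?_
  · funext n f
    exact f.elim
  · funext n r a
    cases r with
    | P i => exact congrArg (A.struc.RelMap (MemRel.P i)) (Fin.eq_const_zero a)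
    | K => exact congrArg (A.struc.RelMap MemRel.K) (Fin.eq_const_zero a)
    | R =>
      refine congrArg (A.struc.RelMap MemRel.R) ?_
      funext i
      fin_cases i <;> rfl

theorem MemModel.toFO_ofFO (A : FOModel.{u} memLang) : (MemModel.ofFO A).toFO = A := by
  obtain ⟨A⟩ := A
  have h := MemModel.foStructure_ofFO (@FirstOrder.Language.Theory.ModelType.mk _ _ A _ _ _)
  unfold MemModel.toFO FirstOrder.Language.Theory.ModelType.of
  congr 1
  exact proof_irrel_heq _ _

theorem memModelTranslation_bijOn (𝔏 : MemoryLogic) :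
    Set.BijOn (memModelTranslation.{u} 𝔏) Set.univ Set.univ := by
  let inv : FOPointed.{u} memLang → 𝔏.source.Pointed := fun P => ⟨MemModel.ofFO P.1, P.2 ()⟩
  -- Reading a memory model back from its translation is definitional; the other composite needs the
  -- relation symbols compared on tuples.
  have hl : Function.LeftInverse inv (memModelTranslation 𝔏) := fun P => rfl
  refine Set.bijOn_univ.2 ⟨hl.injective, ?_⟩
  rintro ⟨A, g⟩
  refine ⟨⟨MemModel.ofFO A, g ()⟩, ?_⟩
  refine Sigma.ext (MemModel.toFO_ofFO A) ?_
  exact heq_of_eq rfl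

instance : Countable memLang.Symbols := by
  have : Countable (Σ n, memLang.Functions n) := ⟨fun x => x.2.elim, fun x => x.2.elim⟩
  have : Countable (Σ n, memLang.Relations n) := by
    let f : (Σ n, memLang.Relations n) → ℕ ⊕ Bool := fun x =>
      match x with
      | ⟨_, .P i⟩ => .inl i
      | ⟨_, .K⟩ => .inr true
      | ⟨_, .R⟩ => .inr false
    refine Function.Injective.countable (f := f) ?_
    rintro ⟨_, r⟩ ⟨_, s⟩ h
    cases r <;> cases s <;> simp_all [f]
  exact inferInstanceAs (Countable (_ ⊕ _))

/-! ### First-order formulas over memory models -/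

/-- Truth of a first-order formula in a memory model. -/
def MemModel.Holds {β : Type*} (M : MemModel.{u}) (α : memLang.Formula β) (v : β → M.W) : Prop :=
  FirstOrder.Language.Formula.Realize (M := M.toFO) α v

namespace MemModel

variable {β γ : Type} (M : MemModel.{u}) (v : β → M.W)

theorem holds_not (α : memLang.Formula β) : M.Holds (∼α) v ↔ ¬ M.Holds α v :=
  FirstOrder.Language.Formula.realize_not

theorem holds_inf (α α' : memLang.Formula β) :
    M.Holds (α ⊓ α') v ↔ M.Holds α v ∧ M.Holds α' v :=
  FirstOrder.Language.Formula.realize_inf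

theorem holds_sup (α α' : memLang.Formula β) :
    M.Holds (α ⊔ α') v ↔ M.Holds α v ∨ M.Holds α' v :=
  FirstOrder.Language.Formula.realize_sup

theorem holds_imp (α α' : memLang.Formula β) :
    M.Holds (α.imp α') v ↔ (M.Holds α v → M.Holds α' v) :=
  FirstOrder.Language.Formula.realize_imp

theorem holds_iff (α α' : memLang.Formula β) :
    M.Holds (α.iff α') v ↔ (M.Holds α v ↔ M.Holds α' v) :=
  FirstOrder.Language.Formula.realize_iff

theorem holds_top : M.Holds ⊤ v ↔ True :=
  FirstOrder.Language.Formula.realize_top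

theorem holds_bot : M.Holds ⊥ v ↔ False :=
  FirstOrder.Language.Formula.realize_bot

theorem holds_relabel (g : γ → β) (α : memLang.Formula γ) :
    M.Holds (α.relabel g) v ↔ M.Holds α (v ∘ g) :=
  FirstOrder.Language.Formula.realize_relabel

theorem holds_iExs (α : memLang.Formula (β ⊕ Unit)) :
    M.Holds (α.iExs Unit) v ↔ ∃ w, M.Holds α (Sum.elim v fun _ => w) :=
  FirstOrder.Language.Formula.realize_iExs.trans
    ⟨fun ⟨i, hi⟩ => ⟨i (), hi⟩, fun ⟨w, hw⟩ => ⟨fun _ => w, hw⟩⟩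

theorem holds_equal (x y : β) :
    M.Holds ((FirstOrder.Language.Term.var x).equal (FirstOrder.Language.Term.var y)) v ↔
      v x = v y :=
  FirstOrder.Language.Formula.realize_equal

theorem holds_P (i : ℕ) (x : β) :
    M.Holds (FirstOrder.Language.Relations.formula₁ (L := memLang) (MemRel.P i)
      (FirstOrder.Language.Term.var x)) v ↔ v x ∈ M.V i :=
  FirstOrder.Language.Formula.realize_rel

theorem holds_K (x : β) :
    M.Holds (FirstOrder.Language.Relations.formula₁ (L := memLang) MemRel.K
      (FirstOrder.Language.Term.var x)) v ↔ v x ∈ M.S :=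
  FirstOrder.Language.Formula.realize_rel

theorem holds_R (x y : β) :
    M.Holds (FirstOrder.Language.Relations.formula₂ (L := memLang) MemRel.R
      (FirstOrder.Language.Term.var x) (FirstOrder.Language.Term.var y)) v ↔ M.R (v x) (v y) :=
  FirstOrder.Language.Formula.realize_rel

/-- The memory model with memory `S`. -/
abbrev setMemory (S : Set M.W) : MemModel.{u} :=
  { M with S := S }

/-- The set defined by the formula `κ` with parameters `v`. -/
def extension (κ : memLang.Formula (β ⊕ Unit)) : Set M.W :=
  {w | M.Holds κ (Sum.elim v fun _ => w)}

end MemModel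

/-- The formula `κ(y) ∨ y = x`. -/
def rememberFormula {β : Type} (κ : memLang.Formula (β ⊕ Unit)) (x : β) :
    memLang.Formula (β ⊕ Unit) :=
  κ ⊔ (FirstOrder.Language.Term.var (.inr ())).equal (FirstOrder.Language.Term.var (.inl x))

/-- The formula `κ(y) ∧ y ≠ x`. -/
def forgetFormula {β : Type} (κ : memLang.Formula (β ⊕ Unit)) (x : β) :
    memLang.Formula (β ⊕ Unit) :=
  κ ⊓ ∼((FirstOrder.Language.Term.var (.inr ())).equal (FirstOrder.Language.Term.var (.inl x)))

/-- The formula `κ` with an additional parameter. -/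
def weakenFormula {β : Type} (κ : memLang.Formula (β ⊕ Unit)) :
    memLang.Formula ((β ⊕ Unit) ⊕ Unit) :=
  κ.relabel (Sum.map Sum.inl id)

namespace MemModel

variable {β : Type} (M : MemModel.{u}) (v : β → M.W) (κ : memLang.Formula (β ⊕ Unit))

theorem extension_remember (x : β) :
    M.extension v (rememberFormula κ x) = M.extension v κ ∪ {v x} := by
  ext w
  simp only [extension, rememberFormula, holds_sup, holds_equal, Set.mem_ofPred_eq, Set.mem_union,
    Set.mem_singleton_iff, Sum.elim_inl, Sum.elim_inr]

theorem extension_forget (x : β) :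
    M.extension v (forgetFormula κ x) = M.extension v κ \ {v x} := by
  ext w
  simp only [extension, forgetFormula, holds_inf, holds_not, holds_equal, Set.mem_ofPred_eq,
    Set.mem_sdiff, Set.mem_singleton_iff, Sum.elim_inl, Sum.elim_inr]

theorem extension_bot : M.extension v (⊥ : memLang.Formula (β ⊕ Unit)) = ∅ :=
  Set.eq_empty_of_forall_notMem fun _ hw => (M.holds_bot _).1 hw

theorem extension_weaken (m : M.W) :
    M.extension (Sum.elim v fun _ => m) (weakenFormula κ) = M.extension v κ := by
  ext w
  simp [extension, weakenFormula, holds_relabel, Sum.elim_comp_map]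

theorem extension_known : M.extension v (FirstOrder.Language.Relations.formula₁ (L := memLang)
    MemRel.K (FirstOrder.Language.Term.var (.inr ()))) = M.S :=
  Set.ext fun w => M.holds_K (Sum.elim v fun _ => w) (.inr ())

end MemModel

/-! ### The formula translation of memory logics -/

/-- `κ` describes the current memory inside the unchanged structure. Remember, forget and erase only
rewrite `κ`; a diamond adds a variable for the new point. The induction therefore ranges over all
`β`, `κ` and `x`. -/
theorem MemFormula.exists_translation {𝔏 : MemoryLogic} (φ : MemFormula 𝔏) :
    ∀ (β : Type) (κ : memLang.Formula (β ⊕ Unit)) (x : β), ∃ α : memLang.Formula β,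
      ∀ (M : MemModel.{u}) (v : β → M.W), φ.Sat (M.setMemory (M.extension v κ)) (v x) ↔ M.Holds α v := by
  induction φ with
  | var i => exact fun β κ x => ⟨_, fun M v => (M.holds_P v i x).symm⟩
  | verum => exact fun β κ x => ⟨⊤, fun M v => (M.holds_top v).symm⟩
  | falsum => exact fun β κ x => ⟨⊥, fun M v => (M.holds_bot v).symm⟩
  | neg φ ih =>
    intro β κ x
    obtain ⟨α, hα⟩ := ih β κ x
    exact ⟨∼α, fun M v => by rw [MemModel.holds_not, ← hα]; rfl⟩
  | conj φ ψ ih ih' =>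
    intro β κ x
    obtain ⟨α, hα⟩ := ih β κ x
    obtain ⟨α', hα'⟩ := ih' β κ x
    exact ⟨α ⊓ α', fun M v => by rw [MemModel.holds_inf, ← hα, ← hα']; rfl⟩
  | disj φ ψ ih ih' =>
    intro β κ x
    obtain ⟨α, hα⟩ := ih β κ x
    obtain ⟨α', hα'⟩ := ih' β κ x
    exact ⟨α ⊔ α', fun M v => by rw [MemModel.holds_sup, ← hα, ← hα']; rfl⟩
  | imp φ ψ ih ih' =>
    intro β κ x
    obtain ⟨α, hα⟩ := ih β κ x
    obtain ⟨α', hα'⟩ := ih' β κ x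
    exact ⟨α.imp α', fun M v => by rw [MemModel.holds_imp, ← hα, ← hα']; rfl⟩
  | iff φ ψ ih ih' =>
    intro β κ x
    obtain ⟨α, hα⟩ := ih β κ x
    obtain ⟨α', hα'⟩ := ih' β κ x
    exact ⟨α.iff α', fun M v => by rw [MemModel.holds_iff, ← hα, ← hα']; rfl⟩
  | known h =>
    intro β κ x
    -- Substitute `x` for the distinguished variable of `κ`.
    refine ⟨κ.relabel (Sum.elim id fun _ => x), fun M v => ?_⟩
    rw [MemModel.holds_relabel, Sum.comp_elim]
    rfl
  | remember h φ ih =>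
    intro β κ x
    obtain ⟨α, hα⟩ := ih β (rememberFormula κ x) x
    exact ⟨α, fun M v => by rw [← hα, MemModel.extension_remember]; rfl⟩
  | forget h φ ih =>
    intro β κ x
    obtain ⟨α, hα⟩ := ih β (forgetFormula κ x) x
    exact ⟨α, fun M v => by rw [← hα, MemModel.extension_forget]; rfl⟩
  | erase h φ ih =>
    intro β κ x
    obtain ⟨α, hα⟩ := ih β ⊥ x
    exact ⟨α, fun M v => by rw [← hα, MemModel.extension_bot]; rfl⟩
  | diamond h φ ih =>
    intro β κ x
    obtain ⟨α, hα⟩ := ih (β ⊕ Unit) (weakenFormula κ) (.inr ())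
    refine ⟨(FirstOrder.Language.Relations.formula₂ (L := memLang) MemRel.R
      (FirstOrder.Language.Term.var (.inl x)) (FirstOrder.Language.Term.var (.inr ())) ⊓
      α).iExs Unit, fun M v => ?_⟩
    rw [MemModel.holds_iExs]
    refine exists_congr fun (w : M.W) => ?_
    rw [MemModel.holds_inf, MemModel.holds_R, ← hα, MemModel.extension_weaken]
    rfl
  | doubleDiamond h φ ih =>
    intro β κ x
    obtain ⟨α, hα⟩ := ih (β ⊕ Unit) (weakenFormula (rememberFormula κ x)) (.inr ())
    refine ⟨(FirstOrder.Language.Relations.formula₂ (L := memLang) MemRel.R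
      (FirstOrder.Language.Term.var (.inl x)) (FirstOrder.Language.Term.var (.inr ())) ⊓
      α).iExs Unit, fun M v => ?_⟩
    rw [MemModel.holds_iExs]
    refine exists_congr fun (w : M.W) => ?_
    rw [MemModel.holds_inf, MemModel.holds_R, ← hα, MemModel.extension_weaken,
      MemModel.extension_remember]
    rfl

theorem exists_truthPreserving (𝔏 : MemoryLogic) :
    ∃ Tf : (MemoryLogic.source.{u} 𝔏).Form → memLang.Formula Unit,
      TruthPreserving.{u} 𝔏.source Tf (memModelTranslation 𝔏) := by
  choose Tf hTf using fun φ : MemFormula 𝔏 => φ.exists_translation.{u} Unit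
    (FirstOrder.Language.Relations.formula₁ (L := memLang) MemRel.K
      (FirstOrder.Language.Term.var (.inr ()))) ()
  refine ⟨Tf, fun φ P => ?_⟩
  have := hTf φ P.1 fun _ => P.2
  rwa [MemModel.extension_known] at this

/-- Every first-order pointed model is a translation, so truth preservation at source conjunctions
and disjunctions is already logical equivalence. -/
theorem TruthPreserving.isFormulaTranslation {𝔏 : SourceLogic.{u}}
    {L : FirstOrder.Language.{0, 0}} {Tf : 𝔏.Form → L.Formula Unit}
    {T : 𝔏.Pointed → FOPointed.{u} L} (hT : TruthPreserving 𝔏 Tf T)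
    (hsurj : Function.Surjective T) : IsFormulaTranslation 𝔏 Tf := by
  refine ⟨fun φ ψ => ⟨𝔏.conj φ ψ, fun A _ => ?_⟩, fun φ ψ => ⟨𝔏.disj φ ψ, fun A _ => ?_⟩⟩
  · obtain ⟨P, rfl⟩ := hsurj A
    rw [← hT, 𝔏.sat_conj, hT, hT]
    exact FirstOrder.Language.Formula.realize_inf.symm
  · obtain ⟨P, rfl⟩ := hsurj A
    rw [← hT, 𝔏.sat_disj, hT, hT]
    exact FirstOrder.Language.Formula.realize_sup.symm

/-! ### Simulations of memory logics -/

theorem IsMemSimulation.sat_iff {𝔏 : MemoryLogic} {Z : MemPointed.{u} → MemPointed.{u} → Prop}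
    (hZ : IsMemSimulation 𝔏 Z) (φ : MemFormula 𝔏) :
    ∀ (M N : MemModel.{u}) (m : M.W) (n : N.W), Z ⟨M, m⟩ ⟨N, n⟩ → (φ.Sat M m ↔ φ.Sat N n) := by
  induction φ with
  | var i => exact fun M N m n h => hZ.agree M N m n h i
  | verum => exact fun _ _ _ _ _ => Iff.rfl
  | falsum => exact fun _ _ _ _ _ => Iff.rfl
  | neg φ ih => exact fun M N m n h => not_congr (ih M N m n h)
  | conj φ ψ ih ih' => exact fun M N m n h => and_congr (ih M N m n h) (ih' M N m n h)
  | disj φ ψ ih ih' => exact fun M N m n h => or_congr (ih M N m n h) (ih' M N m n h)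
  | imp φ ψ ih ih' => exact fun M N m n h => imp_congr (ih M N m n h) (ih' M N m n h)
  | iff φ ψ ih ih' => exact fun M N m n h => iff_congr (ih M N m n h) (ih' M N m n h)
  | known hk => exact hZ.kagree hk
  | remember hr φ ih => exact fun M N m n h => ih _ _ _ _ (hZ.remember hr M N m n h)
  | forget hf φ ih => exact fun M N m n h => ih _ _ _ _ (hZ.forget hf M N m n h)
  | erase he φ ih => exact fun M N m n h => ih _ _ _ _ (hZ.erase he M N m n h)
  | diamond hd φ ih =>
    intro M N m n h
    constructor
    · rintro ⟨m', hm, hφ⟩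
      obtain ⟨n', hn, h'⟩ := hZ.forth hd M N m n h m' hm
      exact ⟨n', hn, (ih _ _ _ _ h').1 hφ⟩
    · rintro ⟨n', hn, hφ⟩
      obtain ⟨m', hm, h'⟩ := hZ.back hd M N m n h n' hn
      exact ⟨m', hm, (ih _ _ _ _ h').2 hφ⟩
  | doubleDiamond hd φ ih =>
    intro M N m n h
    constructor
    · rintro ⟨m', hm, hφ⟩
      obtain ⟨n', hn, h'⟩ := hZ.mforth hd M N m n h m' hm
      exact ⟨n', hn, (ih _ _ _ _ h').1 hφ⟩
    · rintro ⟨n', hn, hφ⟩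
      obtain ⟨m', hm, h'⟩ := hZ.mback hd M N m n h n' hn
      exact ⟨m', hm, (ih _ _ _ _ h').2 hφ⟩

/-- `M` arises from an `ω`-saturated memory model by changing the memory to a set that is
first-order definable with parameters. -/
def MemModel.Saturated (M : MemModel.{u}) : Prop :=
  ∃ (N : MemModel.{u}) (β : Type) (_ : Finite β) (v : β → N.W) (κ : memLang.Formula (β ⊕ Unit)),
    N.toFO.OmegaSaturated ∧ M = N.setMemory (N.extension v κ)

namespace MemModel.Saturated

variable {M N : MemModel.{u}}

theorem of_omegaSaturated (h : M.toFO.OmegaSaturated) : M.Saturated :=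
  ⟨M, Empty, inferInstance, Empty.elim, _, h, congrArg M.setMemory (M.extension_known _).symm⟩

/-- The remembered point becomes one more parameter, and the parameters stay finite in number. -/
theorem remember (h : M.Saturated) (m : M.W) : (M.remember m).Saturated := by
  obtain ⟨N, β, _, v, κ, hN, rfl⟩ := h
  refine ⟨N, β ⊕ Unit, inferInstance, Sum.elim v fun _ => (m : N.W),
    rememberFormula (weakenFormula κ) (.inr ()), hN, ?_⟩
  rw [extension_remember]
  exact congrArg (fun S => N.setMemory (S ∪ {m})) (N.extension_weaken v κ m).symm

theorem forget (h : M.Saturated) (m : M.W) : (M.forget m).Saturated := by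
  obtain ⟨N, β, _, v, κ, hN, rfl⟩ := h
  refine ⟨N, β ⊕ Unit, inferInstance, Sum.elim v fun _ => (m : N.W),
    forgetFormula (weakenFormula κ) (.inr ()), hN, ?_⟩
  rw [extension_forget]
  exact congrArg (fun S => N.setMemory (S \ {m})) (N.extension_weaken v κ m).symm

theorem erase (h : M.Saturated) : M.erase.Saturated := by
  obtain ⟨N, β, _, v, κ, hN, rfl⟩ := h
  exact ⟨N, β, inferInstance, v, ⊥, hN, congrArg N.setMemory (N.extension_bot v).symm⟩

/-- Modal saturation: $R(m,y)$ and the translations of `Γ` at $y$ relative to `κ` form a type with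
finitely many parameters over the underlying $\omega$-saturated model. -/
theorem exists_successor {𝔏 : MemoryLogic} (h : M.Saturated) (m : M.W) (Γ : Set (MemFormula 𝔏))
    (hΓ : ∀ Δ ⊆ Γ, Δ.Finite → ∃ m', M.R m m' ∧ ∀ φ ∈ Δ, φ.Sat M m') :
    ∃ m', M.R m m' ∧ ∀ φ ∈ Γ, φ.Sat M m' := by
  obtain ⟨N, β, _, v, κ, hN, rfl⟩ := h
  -- `κ` is weakened twice, for the parameter `m` and for the sought successor, which is the point
  -- of evaluation.
  choose tr htr using fun φ : MemFormula 𝔏 => φ.exists_translation.{u} ((β ⊕ Unit) ⊕ Unit)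
    (weakenFormula (weakenFormula κ)) (.inr ())
  let ρ : memLang.Formula ((β ⊕ Unit) ⊕ Unit) :=
    FirstOrder.Language.Relations.formula₂ (L := memLang) MemRel.R
      (FirstOrder.Language.Term.var (.inl (.inr ()))) (FirstOrder.Language.Term.var (.inr ()))
  let v' : β ⊕ Unit → N.W := Sum.elim v fun _ => m
  have hρ : ∀ w : N.W, N.Holds ρ (Sum.elim v' fun _ => w) ↔ N.R m w := fun w =>
    N.holds_R (Sum.elim v' fun _ => w) (.inl (.inr ())) (.inr ())
  have htr' : ∀ (φ : MemFormula 𝔏) (w : N.W), N.Holds (tr φ) (Sum.elim v' fun _ => w) ↔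
      φ.Sat (N.setMemory (N.extension v κ)) w := by
    intro φ w
    rw [← htr, extension_weaken]
    exact iff_of_eq (congrArg (fun S => φ.Sat (N.setMemory S) w) (N.extension_weaken v κ m))
  obtain ⟨w, hw⟩ := hN.exists_realize v' (insert ρ (tr '' Γ)) (by
    intro Δ hΔ hfin
    obtain ⟨Δ', hsub, hfin', hΔ'⟩ : ∃ Δ' ⊆ Γ, Δ'.Finite ∧ Δ \ {ρ} = tr '' Δ' :=
      Set.exists_subset_image_finite_and.1 ⟨Δ \ {ρ}, by
        rintro α ⟨hα, hne⟩
        exact (hΔ hα).resolve_left hne, hfin.subset Set.sdiff_subset, rfl⟩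
    obtain ⟨w, hR, hw⟩ := hΓ Δ' hsub hfin'
    refine ⟨w, fun α hα => ?_⟩
    by_cases hne : α = ρ
    · rw [hne]
      exact (hρ w).2 hR
    · obtain ⟨φ, hφ, rfl⟩ : α ∈ tr '' Δ' := hΔ' ▸ ⟨hα, hne⟩
      exact (htr' φ w).2 (hw φ hφ))
  exact ⟨w, (hρ w).1 (hw ρ (Set.mem_insert _ _)), fun φ hφ =>
    (htr' φ w).1 (hw _ (Set.mem_insert_of_mem _ ⟨φ, hφ, rfl⟩))⟩

/-- If every formula true at some successor of `m` is true at some successor of `n`, then every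
successor of `m` is matched by a successor of `n` with the same theory. -/
theorem exists_successor_sat_iff {𝔏 : MemoryLogic} (hN : N.Saturated) {m : M.W} {n : N.W}
    (hsucc : ∀ φ : MemFormula 𝔏, (∃ m', M.R m m' ∧ φ.Sat M m') → ∃ n', N.R n n' ∧ φ.Sat N n')
    (m' : M.W) (hm : M.R m m') :
    ∃ n', N.R n n' ∧ ∀ φ : MemFormula 𝔏, φ.Sat M m' ↔ φ.Sat N n' := by
  obtain ⟨n', hn, h⟩ := hN.exists_successor n {φ : MemFormula 𝔏 | φ.Sat M m'} (by
    intro Δ hΔ hfin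
    obtain ⟨ψ, hψ⟩ := SourceLogic.exists_finset_conj.{u} 𝔏.source hfin.toFinset
    obtain ⟨n', hn, hsat⟩ := hsucc ψ ⟨m', hm, (hψ ⟨M, m'⟩).2 fun φ hφ =>
      hΔ (hfin.mem_toFinset.1 hφ)⟩
    exact ⟨n', hn, fun φ hφ => (hψ ⟨N, n'⟩).1 hsat φ (hfin.mem_toFinset.2 hφ)⟩)
  refine ⟨n', hn, fun φ => ⟨fun hφ => h φ hφ, fun hφ => ?_⟩⟩
  by_contra hcon
  -- Negation in the language turns inclusion of theories into equality.
  exact h (.neg φ) hcon hφ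

end MemModel.Saturated

/-- Equality of theories between saturated models. -/
def SaturatedEquiv (𝔏 : MemoryLogic) (P Q : MemPointed.{u}) : Prop :=
  P.1.Saturated ∧ Q.1.Saturated ∧ ∀ φ : MemFormula 𝔏, φ.Sat P.1 P.2 ↔ φ.Sat Q.1 Q.2

theorem SaturatedEquiv.symm {𝔏 : MemoryLogic} {P Q : MemPointed.{u}}
    (h : SaturatedEquiv 𝔏 P Q) : SaturatedEquiv 𝔏 Q P :=
  ⟨h.2.1, h.1, fun φ => (h.2.2 φ).symm⟩

theorem SaturatedEquiv.remember {𝔏 : MemoryLogic} {M N : MemModel.{u}} {m : M.W} {n : N.W}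
    (h : SaturatedEquiv 𝔏 ⟨M, m⟩ ⟨N, n⟩) :
    SaturatedEquiv 𝔏 ⟨M.remember m, m⟩ ⟨N.remember n, n⟩ :=
  ⟨h.1.remember m, h.2.1.remember n, fun φ => h.2.2 (.remember 𝔏.remember_mem φ)⟩

theorem SaturatedEquiv.forth {𝔏 : MemoryLogic} (hd : MemOp.diamond ∈ 𝔏.ops) {M N : MemModel.{u}}
    {m : M.W} {n : N.W} (h : SaturatedEquiv 𝔏 ⟨M, m⟩ ⟨N, n⟩) (m' : M.W) (hm : M.R m m') :
    ∃ n', N.R n n' ∧ SaturatedEquiv 𝔏 ⟨M, m'⟩ ⟨N, n'⟩ := by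
  obtain ⟨n', hn, h'⟩ := h.2.1.exists_successor_sat_iff
    (fun φ hφ => (h.2.2 (.diamond hd φ)).1 hφ) m' hm
  exact ⟨n', hn, h.1, h.2.1, h'⟩

/-- Remembering leaves the accessibility relation alone, so a double diamond at `m` speaks of
successors of `m` in the remembered model, to which modal saturation applies. -/
theorem SaturatedEquiv.mforth {𝔏 : MemoryLogic} (hd : MemOp.doubleDiamond ∈ 𝔏.ops)
    {M N : MemModel.{u}} {m : M.W} {n : N.W} (h : SaturatedEquiv 𝔏 ⟨M, m⟩ ⟨N, n⟩) (m' : M.W)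
    (hm : M.R m m') :
    ∃ n', N.R n n' ∧ SaturatedEquiv 𝔏 ⟨M.remember m, m'⟩ ⟨N.remember n, n'⟩ := by
  obtain ⟨n', hn, h'⟩ := h.remember.2.1.exists_successor_sat_iff (M := M.remember m) (m := m)
    (n := n) (fun φ hφ => (h.2.2 (.doubleDiamond hd φ)).1 hφ) m' hm
  exact ⟨n', hn, h.remember.1, h.remember.2.1, h'⟩

theorem SaturatedEquiv.isMemSimulation {𝔏 : MemoryLogic} {P Q : MemPointed.{u}}
    (h : SaturatedEquiv 𝔏 P Q) : IsMemSimulation 𝔏 (SaturatedEquiv.{u} 𝔏) where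
  nontriv := ⟨P, Q, h⟩
  agree M N m n h i := h.2.2 (.var i)
  kagree hk M N m n h := h.2.2 (.known hk)
  remember _ M N m n h := h.remember
  forget hf M N m n h := ⟨h.1.forget m, h.2.1.forget n, fun φ => h.2.2 (.forget hf φ)⟩
  erase he M N m n h := ⟨h.1.erase, h.2.1.erase, fun φ => h.2.2 (.erase he φ)⟩
  forth hd M N m n h := h.forth hd
  back hd M N m n h n' hn := by
    obtain ⟨m', hm, h'⟩ := h.symm.forth hd n' hn
    exact ⟨m', hm, h'.symm⟩
  mforth hd M N m n h := h.mforth hd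
  mback hd M N m n h n' hn := by
    obtain ⟨m', hm, h'⟩ := h.symm.mforth hd n' hn
    exact ⟨m', hm, h'.symm⟩

theorem memSimulation_isSimulationNotion (𝔏 : MemoryLogic) :
    IsSimulationNotion.{u} 𝔏.source (memSimulation 𝔏) :=
  fun _ hZ => ⟨hZ.nontriv, fun P Q hPQ φ hφ =>
    (IsMemSimulation.sat_iff hZ φ P.1 Q.1 P.2 Q.2 hPQ).1 hφ⟩

theorem memSimulation_hennessyMilner (𝔏 : MemoryLogic) :
    HennessyMilner.{u} 𝔏.source (memSimulation 𝔏)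
      {P | FOModel.OmegaSaturated (memModelTranslation 𝔏 P).1} := by
  intro P hP Q hQ h
  have hPQ : SaturatedEquiv 𝔏 P Q := by
    refine ⟨.of_omegaSaturated hP, .of_omegaSaturated hQ, fun φ => ⟨fun hφ => h hφ, fun hφ => ?_⟩⟩
    by_contra hcon
    exact h (show MemFormula.neg φ ∈ 𝔏.source.Th P from hcon) hφ
  exact ⟨SaturatedEquiv 𝔏, hPQ.isMemSimulation, hPQ⟩

theorem isAdequatePair_of_truthPreserving {𝔏 : MemoryLogic}
    {Tf : (MemoryLogic.source.{u} 𝔏).Form → memLang.Formula Unit}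
    (hTf : TruthPreserving.{u} 𝔏.source Tf (memModelTranslation 𝔏)) :
    IsAdequatePair.{u} 𝔏.source Set.univ Tf (memModelTranslation 𝔏) (memSimulation 𝔏) where
  closed _ _ _ _ := Set.mem_univ _
  formula_translation :=
    hTf.isFormulaTranslation (Set.bijOn_univ.1 (memModelTranslation_bijOn 𝔏)).surjective
  model_translation := memModelTranslation_bijOn 𝔏
  truth_preserving := hTf
  simulation := memSimulation_isSimulationNotion 𝔏
  hennessy_milner := memSimulation_hennessyMilner 𝔏

/-- For every memory logic `𝔏`, with `K` the class of all first-order (pointed) models of the target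
signature: `⟨𝔏, K⟩` is an adequate pair, and the characterization theorem and the two definability
theorems hold for it. -/
theorem mainTheorem5 (𝔏 : MemoryLogic) :
    -- adequacy
    (∃ Tf : 𝔏.source.Form → memLang.Formula Unit,
      IsAdequatePair.{u} 𝔏.source Set.univ Tf (memModelTranslation 𝔏) (memSimulation 𝔏)) ∧
    -- characterization
    (∀ Tf : 𝔏.source.Form → memLang.Formula Unit,
      IsFormulaTranslation.{u} 𝔏.source Tf →
      TruthPreserving.{u} 𝔏.source Tf (memModelTranslation 𝔏) →
      ∀ α : memLang.Formula Unit,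
        (∃ φ : 𝔏.source.Form,
          KEquivalent (Set.univ : Set (FOPointed.{u} memLang)) α (Tf φ)) ↔
        SimulationInvariant.{u} 𝔏.source (memModelTranslation 𝔏) (memSimulation 𝔏) α) ∧
    -- definability by a set of formulas
    (∀ M : Set (SourceLogic.Pointed.{u} 𝔏.source),
      DefinableBySet 𝔏.source M ↔
        ClosedUnderSimulations 𝔏.source (memSimulation 𝔏) M ∧
        ClosedUnderUltraproducts (memModelTranslation 𝔏 '' M) ∧
        ClosedUnderUltrapowers (memModelTranslation 𝔏 '' Mᶜ)) ∧
    -- definability by a single formula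
    (∀ M : Set (SourceLogic.Pointed.{u} 𝔏.source),
      DefinableByFormula 𝔏.source M ↔
        ClosedUnderSimulations 𝔏.source (memSimulation 𝔏) M ∧
        ClosedUnderUltraproducts (memModelTranslation 𝔏 '' M) ∧
        ClosedUnderUltraproducts (memModelTranslation 𝔏 '' Mᶜ)) := by
  obtain ⟨Tf, hTf⟩ := exists_truthPreserving.{u} 𝔏
  have h := isAdequatePair_of_truthPreserving hTf
  -- The definability statements do not mention the formula translation, so one translation serves
  -- for them; the characterization uses adequacy of each given one.
  exact ⟨⟨Tf, h⟩,
    fun _ _ hTf' α => (isAdequatePair_of_truthPreserving hTf').exists_kEquivalent_iff α,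
    h.definableBySet_iff, h.definableByFormula_iff⟩
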